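/- Let $G$ be a (discrete) group. Let $\mathcal G$ be the groupoid of the adjoint action of $G$: its objects are the elements of $G$, $\mathrm{Mor}(a,b)=\{x\in G: xax^{-1}=b\}$, and the composite of $x:a\to b$ and $y:b\to c$ is $yx$. For a conjugacy class $c$ of $G$ let $\mathcal G_{c}$ be the full subgroupoid of $\mathcal G$ on the elements of $c$. Let $r\mathcal G$ be the groupoid of the right action of $G$ on itself: its objects are the elements of $G$, $\mathrm{Mor}(a,b)=\{x\in G: ax=b\}$, and the composite of $x:a\to b$ and $y:b\to c$ is $xy$. The group $G$ acts on $r\mathcal G$, and hence on its classifying space, by left translations ($h$ sends the object $a$ to $ha$ and the morphism $x:a\to b$ to $x:ha\to hb$). The classifying space $B\mathcal C$ of a category $\mathcal C$ is the geometric realization of its nerve. For $g\in G$ let $\langle g\rangle$ be its conjugacy class and $C(g)=\{h\in G: hg=gh\}$ its centralizer. Then: 1. The inclusions $\mathcal G_{c}\hookrightarrow\mathcal G$ induce a homeomorphism $$\coprod_{c}B\mathcal G_{c}\;\xrightarrow{\ \approx\ }\;B\mathcal G ,$$ where $c$ runs over the conjugacy classes of $G$. 2. For every $g\in G$ the space $B\mathcal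 G_{\langle g\rangle}$ is homeomorphic to the orbit space $(Br\mathcal G)/C(g)$ of the action of $C(g)\subseteq G$ on $Br\mathcal G$ by left translations. 3. For every $g\in G$ the space $B\mathcal G_{\langle g\rangle}$ is an Eilenberg–MacLane space $K(C(g),1)$: it is path connected, its fundamental group at every base point is isomorphic to $C(g)$, and $\pi_n(B\mathcal G_{\langle g\rangle},x)$ is trivial for all $n\ge 2$ and all base points $x$. Moreover it is homotopy equivalent to the classifying space $BC(g)$ of the group $C(g)$, regarded as a category with one object. -/

import Mathlib

open CategoryTheory

universe u v w

/-- The classifying space `BC` of a category: the geometric realization of its nerve, whose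
`k`-simplices are the strings of `k` composable morphisms. -/
noncomputable abbrev ClassifyingSpace (C : Type u) [Category.{v} C] : TopCat.{max u v} :=
  SSet.toTop.obj (nerve C)

/-- The continuous map of classifying spaces induced by a functor. -/
noncomputable def classifyingSpaceMap {C D : Type u} [Category.{v} C] [Category.{v} D]
    (F : C ⥤ D) : ClassifyingSpace C ⟶ ClassifyingSpace D :=
  SSet.toTop.map (nerveMap F)

/-- The objects of the groupoid of the adjoint action of `G` on itself: the elements of `G`. -/
@[ext]
structure AdjointGroupoid (G : Type u) where
  /-- the underlying element of the group -/
  elt : G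

namespace AdjointGroupoid

variable {G : Type u} [Group G]

/-- A morphism `a ⟶ b` is an `x` with `x * a * x⁻¹ = b`; the composite of `x : a ⟶ b` and
`y : b ⟶ c` is `y * x`. -/
instance : Groupoid.{u} (AdjointGroupoid G) where
  Hom a b := {x : G // x * a.elt * x⁻¹ = b.elt}
  id a := ⟨1, by simp⟩
  comp x y := ⟨y.1 * x.1, by
    obtain ⟨x, hx⟩ := x
    obtain ⟨y, hy⟩ := y
    simp [← hy, ← hx, mul_assoc]⟩
  inv x := ⟨x.1⁻¹, by simp [← show _ = _ from x.2, mul_assoc]⟩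
  id_comp x := Subtype.ext (mul_one x.1)
  comp_id x := Subtype.ext (one_mul x.1)
  assoc x y z := Subtype.ext (mul_assoc z.1 y.1 x.1).symm
  inv_comp x := Subtype.ext (mul_inv_cancel x.1)
  comp_inv x := Subtype.ext (inv_mul_cancel x.1)

/-- The property of an object of being an element of the conjugacy class `c`. -/
def inClass (c : ConjClasses G) : ObjectProperty (AdjointGroupoid G) :=
  fun a => ConjClasses.mk a.elt = c

/-- The full subgroupoid on the elements of the conjugacy class `c`. -/
abbrev Component (c : ConjClasses G) : Type u := (inClass c).FullSubcategory

/-- The map from the disjoint union of the classifying spaces of the subgroupoids of the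
conjugacy classes to the classifying space of the whole groupoid, induced by the inclusions. -/
noncomputable def fromCoproduct (G : Type u) [Group G] :
    (Σ c : ConjClasses G, ClassifyingSpace (Component c)) →
      ClassifyingSpace (AdjointGroupoid G) :=
  fun p => classifyingSpaceMap (inClass p.1).ι p.2

end AdjointGroupoid

/-- The objects of the groupoid of the right action of `G` on itself: the elements of `G`. -/
@[ext]
structure RightGroupoid (G : Type u) where
  /-- the underlying element of the group -/
  elt : G

namespace RightGroupoid

variable {G : Type u} [Group G]

/-- A morphism `a ⟶ b` is an `x` with `a * x = b`; the composite of `x : a ⟶ b` and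
`y : b ⟶ c` is `x * y`. -/
instance : Groupoid.{u} (RightGroupoid G) where
  Hom a b := {x : G // a.elt * x = b.elt}
  id a := ⟨1, mul_one _⟩
  comp x y := ⟨x.1 * y.1, by rw [← mul_assoc, x.2, y.2]⟩
  inv x := ⟨x.1⁻¹, mul_inv_eq_of_eq_mul x.2.symm⟩
  id_comp x := Subtype.ext (one_mul x.1)
  comp_id x := Subtype.ext (mul_one x.1)
  assoc x y z := Subtype.ext (mul_assoc x.1 y.1 z.1)
  inv_comp x := Subtype.ext (inv_mul_cancel x.1)
  comp_inv x := Subtype.ext (mul_inv_cancel x.1)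

instance (a b : RightGroupoid G) : Subsingleton (a ⟶ b) :=
  ⟨fun x y => Subtype.ext (mul_left_cancel (x.2.trans y.2.symm))⟩

/-- Left translation by `h`: it sends the object `a` to `h * a` and the morphism given by `x`
to the morphism given by `x`. -/
def leftTranslation (h : G) : RightGroupoid G ⥤ RightGroupoid G where
  obj a := ⟨h * a.elt⟩
  map x := ⟨x.1, by rw [mul_assoc, x.2]⟩

theorem leftTranslation_one : leftTranslation (1 : G) = 𝟭 (RightGroupoid G) :=
  CategoryTheory.Functor.ext (fun a => RightGroupoid.ext (one_mul a.elt))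
    fun _ _ _ => Subsingleton.elim _ _

theorem leftTranslation_mul (h k : G) :
    leftTranslation (h * k) = leftTranslation k ⋙ leftTranslation h :=
  CategoryTheory.Functor.ext (fun a => RightGroupoid.ext (mul_assoc h k a.elt))
    fun _ _ _ => Subsingleton.elim _ _

/-- The action of `G` on the classifying space of its right action groupoid that is induced by
the left translations. -/
noncomputable instance : MulAction G (ClassifyingSpace (RightGroupoid G)) where
  smul h p := classifyingSpaceMap (leftTranslation h) p
  one_smul p := by
    change classifyingSpaceMap (leftTranslation 1) p = p
    rw [leftTranslation_one]
    change SSet.toTop.map (𝟙 (nerve (RightGroupoid G))) p = p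
    simp
  mul_smul h k p := by
    change classifyingSpaceMap (leftTranslation (h * k)) p =
      classifyingSpaceMap (leftTranslation h) (classifyingSpaceMap (leftTranslation k) p)
    rw [leftTranslation_mul]
    change SSet.toTop.map (nerveMap (leftTranslation k) ≫ nerveMap (leftTranslation h)) p = _
    rw [Functor.map_comp]
    rfl

end RightGroupoid

/-- `X` is an Eilenberg–MacLane space `K(A, 1)`: it is path connected, its fundamental group is
isomorphic to `A`, and its higher homotopy groups vanish. -/
structure IsEilenbergMacLaneOne (A : Type u) [Group A] (X : Type w) [TopologicalSpace X] :
    Prop where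
  pathConnectedSpace : PathConnectedSpace X
  fundamentalGroup : ∀ x : X, Nonempty (FundamentalGroup X x ≃* A)
  higher : ∀ n : ℕ, 2 ≤ n → ∀ x : X, Subsingleton (HomotopyGroup.Pi n X x)

/-! A continuous map out of a realization is the same as a compatible family of maps on simplices
(`RealizationCocone.desc`, `continuousMap_ext`), and every point lies in the image of a simplex
(`exists_realize`). So identities between such maps can be checked on simplices. Part 1: a morphism
of the adjoint groupoid joins conjugate elements, so all vertices of a simplex lie in one class;
this gives the inverse of `fromCoproduct`. Part 2: the functor `a ↦ a⁻¹ * g * a`, `x ↦ x⁻¹` is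
surjective on simplices (`exists_toComponent_lift`), and its fibres are orbits of the centralizer
(`exists_leftTranslation_of_toComponent_eq`). Choosing lifts of simplices therefore gives a
well-defined inverse into the orbit space. Part 3: the right action groupoid has a terminal object,
so its classifying space is contractible. A point with barycentric coordinates `t` on a string of
group elements gives a step function on `[0, 1)`; this is continuous for convergence in measure and
equivariant, and a nontrivial translation moves every step function by distance 1. Hence the action
is a covering action (`exists_nhds_forall_smul_disjoint`); the homotopy groups follow from lifting
to a contractible total space. Finally, the centralizer, as a one-object category, is equivalent to
the component, and natural transformations into groupoids induce homotopies
(`classifyingSpaceMap_homotopic`). -/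

open Opposite

/-- The topological simplex of the dimension of `n`. -/
abbrev TopSimplex (n : SimplexCategory) : Type := stdSimplex ℝ (Fin (n.len + 1))

/-! ### Maps out of a geometric realization, simplex by simplex. -/

namespace SSet

variable {X Y : SSet.{u}}

/-- The characteristic map of a simplex: the continuous map from the topological simplex to the
geometric realization. -/
noncomputable def realize {n : SimplexCategory} (x : X.obj (op n)) :
    C(TopSimplex n, toTop.obj X) :=
  TopCat.toSSetObjEquiv _ (op n) ((sSetTopAdj.unit.app X).app (op n) x)

theorem realize_map {n m : SimplexCategory} (f : n ⟶ m) (x : X.obj (op m))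
    (t : TopSimplex n) :
    realize (X.map f.op x) t = realize x (_root_.stdSimplex.map f t) := by
  have h := ConcreteCategory.congr_hom ((sSetTopAdj.unit.app X).naturality f.op) x
  exact congrArg (fun z => TopCat.toSSetObjEquiv _ (op n) z t) h

theorem toTop_map_realize (φ : X ⟶ Y) {n : SimplexCategory} (x : X.obj (op n))
    (t : TopSimplex n) :
    toTop.map φ (realize x t) = realize (φ.app (op n) x) t := by
  have h := sSetTopAdj.unit.naturality φ
  have h' := ConcreteCategory.congr_hom (NatTrans.congr_app h (op n)) x
  exact (congrArg (fun z => TopCat.toSSetObjEquiv _ (op n) z t) h').symm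

/-- A family of continuous maps, one for each simplex, that is compatible with the simplicial
operators. -/
structure RealizationCocone (X : SSet.{u}) (Z : Type u) [TopologicalSpace Z] where
  /-- the map on the topological simplex that belongs to a simplex -/
  toFun : ∀ {n : SimplexCategory}, X.obj (op n) → C(TopSimplex n, Z)
  map : ∀ {n m : SimplexCategory} (f : n ⟶ m) (x : X.obj (op m))
    (t : TopSimplex n),
    toFun (X.map f.op x) t = toFun x (_root_.stdSimplex.map f t)

namespace RealizationCocone

variable {Z : Type u} [TopologicalSpace Z] (c : RealizationCocone X Z)

/-- The simplicial map to the singular simplicial set that belongs to a cocone. -/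
noncomputable def toSSet : X ⟶ TopCat.toSSet.obj (TopCat.of Z) where
  app n := ↾fun x => (TopCat.toSSetObjEquiv (TopCat.of Z) n).symm (c.toFun (n := n.unop) x)
  naturality n m f := by
    ext x
    apply (TopCat.toSSetObjEquiv (TopCat.of Z) m).injective
    ext t
    exact c.map f.unop x t

/-- The continuous map on the geometric realization that is induced by a cocone. -/
noncomputable def desc : C(toTop.obj X, Z) :=
  ((sSetTopAdj.homEquiv X (TopCat.of Z)).symm c.toSSet).hom

theorem desc_realize {n : SimplexCategory} (x : X.obj (op n))
    (t : TopSimplex n) : c.desc (realize x t) = c.toFun x t := by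
  have h := (sSetTopAdj.homEquiv X (TopCat.of Z)).apply_symm_apply c.toSSet
  rw [Adjunction.homEquiv_unit] at h
  have h' := ConcreteCategory.congr_hom (NatTrans.congr_app h (op n)) x
  exact congrArg (fun z => TopCat.toSSetObjEquiv _ (op n) z t) h'

end RealizationCocone

theorem continuousMap_ext {Z : Type u} [TopologicalSpace Z] {f g : C(toTop.obj X, Z)}
    (h : ∀ {n : SimplexCategory} (x : X.obj (op n)) (t : TopSimplex n),
      f (realize x t) = g (realize x t)) : f = g := by
  have : TopCat.ofHom f = TopCat.ofHom g := by
    apply (sSetTopAdj.homEquiv X (TopCat.of Z)).injective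
    ext n x
    rw [Adjunction.homEquiv_unit, Adjunction.homEquiv_unit]
    apply (TopCat.toSSetObjEquiv (TopCat.of Z) n).injective
    ext t
    exact h (n := n.unop) x t
  exact congrArg TopCat.Hom.hom this

/-- Into an indiscrete space every map is continuous. The predicate of being hit by a characteristic
map and the constant `True` are thus continuous maps that agree on all simplices, hence everywhere.
-/
theorem exists_realize (p : toTop.obj X) :
    ∃ (n : SimplexCategory) (x : X.obj (op n)) (t : TopSimplex n),
      realize x t = p := by
  let : TopologicalSpace (ULift.{u} Prop) := ⊤
  have := continuousMap_ext (X := X) (Z := ULift.{u} Prop)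
    (f := ⟨fun q => ⟨∃ (n : SimplexCategory) (x : X.obj (op n))
      (t : TopSimplex n), realize x t = q⟩, continuous_top⟩)
    (g := ⟨fun _ => ⟨True⟩, continuous_top⟩)
    (fun x t => congrArg ULift.up (eq_true ⟨_, x, t, rfl⟩))
  exact of_eq_true (congrArg ULift.down (DFunLike.congr_fun this p))

end SSet

/-! ### Joining the two images of a string along a natural transformation. -/

section Join

/-- Two diagrams in a groupoid agree if their objects agree, compatibly with trivializations. -/
theorem functor_eq_of_trivialization {J : Type w} [Preorder J] {D : Type u} [Category.{v} D]
    [IsGroupoid D] {K L : J ⥤ D} {A B : D} (a : ∀ j, A ⟶ K.obj j) (b : ∀ j, B ⟶ L.obj j)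
    (hK : ∀ {i j : J} (f : i ⟶ j), a i ≫ K.map f = a j)
    (hL : ∀ {i j : J} (f : i ⟶ j), b i ≫ L.map f = b j)
    (z : A ⟶ B) (h : ∀ j, K.obj j = L.obj j)
    (hab : ∀ j, a j ≫ eqToHom (h j) = z ≫ b j) : K = L := by
  refine CategoryTheory.Functor.ext h fun i j f => ?_
  have : K.map f ≫ eqToHom (h j) = eqToHom (h i) ≫ L.map f := by
    rw [← cancel_epi (a i), reassoc_of% (hK f), hab, reassoc_of% (hab i), hL]
  rw [← reassoc_of% this]
  simp

variable {C D : Type u} [Category.{v} C] [Category.{v} D] {F G : C ⥤ D}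

/-- The objects of the join of the images of a string under two functors. -/
def joinObj (F G : C ⥤ D) {n : ℕ} (x : ComposableArrows C n) :
    Fin (n + 1) ⊕ Fin (n + 1) → D :=
  Sum.elim (fun i => F.obj (x.obj i)) fun i => G.obj (x.obj i)

/-- The morphism from the first object of the join to a given one. -/
def joinTriv (α : F ⟶ G) {n : ℕ} (x : ComposableArrows C n) :
    ∀ k, F.obj (x.obj 0) ⟶ joinObj F G x k
  | .inl i => F.map (x.map (homOfLE (Fin.zero_le i)))
  | .inr i => F.map (x.map (homOfLE (Fin.zero_le i))) ≫ α.app (x.obj i)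

theorem joinTriv_congr (α : F ⟶ G) {n : ℕ} (x : ComposableArrows C n)
    {k l : Fin (n + 1) ⊕ Fin (n + 1)} (h : k = l) :
    joinTriv α x k ≫ eqToHom (congrArg _ h) = joinTriv α x l := by
  subst h
  simp

variable [IsGroupoid D]

theorem joinTriv_inv_assoc (α : F ⟶ G) {n : ℕ} (x : ComposableArrows C n)
    (k l : Fin (n + 1) ⊕ Fin (n + 1)) :
    joinTriv α x k ≫ inv (joinTriv α x k) ≫ joinTriv α x l = joinTriv α x l := by
  simp

/-- The string `F x₀ → ⋯ → F xₙ → G x₀ → ⋯ → G xₙ` in a groupoid. -/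
noncomputable def joinArrows (α : F ⟶ G) {n : ℕ} (x : ComposableArrows C n) :
    ComposableArrows D (n + 1 + n) where
  -- With the length written `n + 1 + n`, the vertex set is definitionally `Fin ((n + 1) + (n +
  -- 1))`. Passing through the initial object makes functoriality a cancellation of inverses.
  obj k := joinObj F G x (finSumFinEquiv (m := n + 1) (n := n + 1).symm k)
  map {k l} _ := inv (joinTriv α x (finSumFinEquiv (m := n + 1) (n := n + 1).symm k)) ≫
    joinTriv α x (finSumFinEquiv (m := n + 1) (n := n + 1).symm l)

/-- The inclusion of the first summand of a join of simplices. -/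
def joinLeft (n : SimplexCategory) : n ⟶ SimplexCategory.mk (n.len + 1 + n.len) :=
  SimplexCategory.mkHom ⟨fun i => Fin.castAdd (n.len + 1) i, fun _ _ h => h⟩

/-- The inclusion of the second summand of a join of simplices. -/
def joinRight (n : SimplexCategory) : n ⟶ SimplexCategory.mk (n.len + 1 + n.len) :=
  SimplexCategory.mkHom ⟨fun i => Fin.natAdd (n.len + 1) i, fun _ _ h => by simpa using h⟩

/-- The join of a map of simplices with itself. -/
def joinMap {n m : SimplexCategory} (f : n ⟶ m) :
    SimplexCategory.mk (n.len + 1 + n.len) ⟶ SimplexCategory.mk (m.len + 1 + m.len) :=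
  SimplexCategory.mkHom ⟨fun k => finSumFinEquiv (m := m.len + 1) (n := m.len + 1)
    (Sum.map f f (finSumFinEquiv (m := n.len + 1) (n := n.len + 1).symm k)), by
      intro k l h
      obtain ⟨k, rfl⟩ := (finSumFinEquiv (m := n.len + 1) (n := n.len + 1)).surjective k
      obtain ⟨l, rfl⟩ := (finSumFinEquiv (m := n.len + 1) (n := n.len + 1)).surjective l
      have hf := (SimplexCategory.Hom.toOrderHom f).monotone
      dsimp only
      rw [Equiv.symm_apply_apply, Equiv.symm_apply_apply]
      rcases k with k | k <;> rcases l with l | l <;>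
        simp only [finSumFinEquiv_apply_left, finSumFinEquiv_apply_right, Sum.map_inl,
          Sum.map_inr] at h ⊢
      · exact hf h
      · refine Fin.le_def.2 ?_
        simp
        omega
      · exact absurd (Fin.le_def.1 h) (by simp; omega)
      · have := hf (show k ≤ l by simpa using h)
        exact Fin.le_def.2 (Nat.add_le_add_left (Fin.le_def.1 this) _)⟩

theorem joinLeft_comp_joinMap {n m : SimplexCategory} (f : n ⟶ m) :
    joinLeft n ≫ joinMap f = f ≫ joinLeft m := by
  ext i
  change ((finSumFinEquiv (m := m.len + 1) (n := m.len + 1)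
    (Sum.map f f ((finSumFinEquiv (m := n.len + 1) (n := n.len + 1)).symm
      (Fin.castAdd (n.len + 1) i))) : Fin _) : ℕ) = _
  rw [finSumFinEquiv_symm_apply_castAdd]
  rfl

theorem joinRight_comp_joinMap {n m : SimplexCategory} (f : n ⟶ m) :
    joinRight n ≫ joinMap f = f ≫ joinRight m := by
  ext i
  change ((finSumFinEquiv (m := m.len + 1) (n := m.len + 1)
    (Sum.map f f ((finSumFinEquiv (m := n.len + 1) (n := n.len + 1)).symm
      (Fin.natAdd (n.len + 1) i))) : Fin _) : ℕ) = _
  rw [finSumFinEquiv_symm_apply_natAdd]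
  rfl

/-- Common form of the three identities below. The joined string is trivialized by `joinTriv`, so
only vertices and trivializations need comparing; `z` accounts for the two trivializations starting
at different objects. -/
theorem nerve_map_joinArrows {n m : SimplexCategory} (α : F ⟶ G) (x : ComposableArrows C n.len)
    (θ : m ⟶ SimplexCategory.mk (n.len + 1 + n.len)) (L : ComposableArrows D m.len)
    (σ : Fin (m.len + 1) → Fin (n.len + 1) ⊕ Fin (n.len + 1))
    (hσ : ∀ k, θ k = finSumFinEquiv (m := n.len + 1) (n := n.len + 1) (σ k))
    {B : D} (b : ∀ j, B ⟶ L.obj j) (hL : ∀ {i j} (f : i ⟶ j), b i ≫ L.map f = b j)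
    (z : F.obj (x.obj 0) ⟶ B) (h : ∀ j, joinObj F G x (σ j) = L.obj j)
    (hab : ∀ j, joinTriv α x (σ j) ≫ eqToHom (h j) = z ≫ b j) :
    (nerve D).map θ.op (joinArrows α x) = L := by
  have hσ' : ∀ k, (finSumFinEquiv (m := n.len + 1) (n := n.len + 1)).symm (θ k) = σ k :=
    fun k => by rw [hσ, Equiv.symm_apply_apply]
  refine functor_eq_of_trivialization
    (K := show Fin (m.len + 1) ⥤ D from (nerve D).map θ.op (joinArrows α x))
    (fun j => joinTriv α x ((finSumFinEquiv (m := n.len + 1) (n := n.len + 1)).symm (θ j)))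
    b (fun {i j} f => ?_) hL z (fun j => (congrArg _ (hσ' j)).trans (h j)) fun j => ?_
  · exact joinTriv_inv_assoc _ _ _ _
  · rw [← hab, ← joinTriv_congr α x (hσ' j), Category.assoc, eqToHom_trans]
    rfl

theorem nerve_map_joinLeft_joinArrows {n : SimplexCategory} (α : F ⟶ G)
    (x : (nerve C).obj (op n)) :
    (nerve D).map (joinLeft n).op (joinArrows α x) = (nerveMap F).app (op n) x := by
  refine nerve_map_joinArrows α x (joinLeft n) _ Sum.inl (fun k => rfl)
    (fun j => F.map (x.map (homOfLE (Fin.zero_le j)))) (fun {i j} f => ?_) (𝟙 _) (fun j => rfl)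
    fun j => ?_
  · exact (F.map_comp _ _).symm.trans (congrArg F.map ((x.map_comp _ _).symm))
  · exact (Category.comp_id _).trans (Category.id_comp _).symm

theorem nerve_map_joinRight_joinArrows {n : SimplexCategory} (α : F ⟶ G)
    (x : (nerve C).obj (op n)) :
    (nerve D).map (joinRight n).op (joinArrows α x) = (nerveMap G).app (op n) x := by
  refine nerve_map_joinArrows α x (joinRight n) _ Sum.inr (fun k => rfl)
    (fun j => G.map (x.map (homOfLE (Fin.zero_le j)))) (fun {i j} f => ?_) (α.app _) (fun j => rfl)
    fun j => ?_
  · exact (G.map_comp _ _).symm.trans (congrArg G.map ((x.map_comp _ _).symm))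
  · exact (Category.comp_id _).trans (α.naturality _)

theorem nerve_map_joinMap_joinArrows {n m : SimplexCategory} (f : n ⟶ m) (α : F ⟶ G)
    (x : (nerve C).obj (op m)) :
    (nerve D).map (joinMap f).op (joinArrows α x) = joinArrows α ((nerve C).map f.op x) := by
  refine nerve_map_joinArrows α x (joinMap f) (joinArrows α ((nerve C).map f.op x))
    (fun k => Sum.map f f ((finSumFinEquiv (m := n.len + 1) (n := n.len + 1)).symm k))
    (fun k => rfl) (fun j => joinTriv α ((nerve C).map f.op x)
      ((finSumFinEquiv (m := n.len + 1) (n := n.len + 1)).symm j)) (fun {i j} f => ?_)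
    -- `f` need not fix the vertex 0, so the base object changes from `x 0` to `x (f 0)`.
    (F.map (x.map (homOfLE (Fin.zero_le (f 0))))) (fun j => ?_)
    fun j => ?_
  · exact joinTriv_inv_assoc _ _ _ _
  · change _ = joinObj F G _ ((finSumFinEquiv (m := n.len + 1) (n := n.len + 1)).symm j)
    cases (finSumFinEquiv (m := n.len + 1) (n := n.len + 1)).symm j <;> rfl
  · have key : ∀ (s : Fin (n.len + 1) ⊕ Fin (n.len + 1))
        (h : joinObj F G x (Sum.map f f s) = joinObj F G ((nerve C).map f.op x) s),
        joinTriv α x (Sum.map f f s) ≫ eqToHom h =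
          F.map (x.map (homOfLE (Fin.zero_le (f 0)))) ≫
            joinTriv α ((nerve C).map f.op x) s := by
      rintro (i | i) h
      · refine (Category.comp_id _).trans (Eq.trans ?_ (F.map_comp _ _))
        exact congrArg F.map (x.map_comp _ _)
      · refine (Category.comp_id _).trans (Eq.trans ?_ (Category.assoc _ _ _))
        refine congrArg (· ≫ α.app _) (Eq.trans ?_ (F.map_comp _ _))
        exact congrArg F.map (x.map_comp _ _)
    exact key _ _

end Join

/-! ### Segments in the join of a simplex with itself. -/

section JoinPoint

/-- The point dividing the segment between two points of a simplex in a given ratio. -/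
noncomputable def stdSimplex.segmentPoint {ι : Type*} [Fintype ι] (p q : stdSimplex ℝ ι)
    (s : unitInterval) : stdSimplex ℝ ι :=
  ⟨(1 - (s : ℝ)) • (p : ι → ℝ) + (s : ℝ) • (q : ι → ℝ),
    convex_stdSimplex ℝ ι p.2 q.2 (sub_nonneg.2 s.2.2) s.2.1 (by ring)⟩

theorem stdSimplex.map_segmentPoint {ι κ : Type*} [Fintype ι] [Fintype κ] (f : ι → κ)
    (p q : stdSimplex ℝ ι) (s : unitInterval) :
    map f (segmentPoint p q s) = segmentPoint (map f p) (map f q) s :=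
  Subtype.ext ((map_add _ _ _).trans (congrArg₂ _ (map_smul _ _ _) (map_smul _ _ _)))

theorem stdSimplex.continuous_segmentPoint {ι : Type*} [Fintype ι] :
    Continuous fun a : (stdSimplex ℝ ι × stdSimplex ℝ ι) × unitInterval =>
      segmentPoint a.1.1 a.1.2 a.2 := by
  refine Continuous.subtype_mk ?_ _
  have h₁ : Continuous fun a : (stdSimplex ℝ ι × stdSimplex ℝ ι) × unitInterval =>
    (a.1.1 : ι → ℝ) := continuous_subtype_val.comp (continuous_fst.comp continuous_fst)
  have h₂ : Continuous fun a : (stdSimplex ℝ ι × stdSimplex ℝ ι) × unitInterval =>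
    (a.1.2 : ι → ℝ) := continuous_subtype_val.comp (continuous_snd.comp continuous_fst)
  exact ((continuous_const.sub (continuous_subtype_val.comp continuous_snd)).smul h₁).add
    ((continuous_subtype_val.comp continuous_snd).smul h₂)

theorem stdSimplex.segmentPoint_zero {ι : Type*} [Fintype ι] (p q : stdSimplex ℝ ι) :
    segmentPoint p q 0 = p :=
  Subtype.ext (by simp [segmentPoint]; rfl)

theorem stdSimplex.segmentPoint_one {ι : Type*} [Fintype ι] (p q : stdSimplex ℝ ι) :
    segmentPoint p q 1 = q :=
  Subtype.ext (by simp [segmentPoint]; rfl)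

/-- The point of the join of a simplex with itself that divides the segment between the two
copies of a point. -/
noncomputable def joinPoint {n : SimplexCategory} (t : TopSimplex n) (s : unitInterval) :
    TopSimplex (SimplexCategory.mk (n.len + 1 + n.len)) :=
  stdSimplex.segmentPoint (stdSimplex.map (joinLeft n) t) (stdSimplex.map (joinRight n) t) s

theorem continuous_joinPoint {n : SimplexCategory} :
    Continuous fun a : TopSimplex n × unitInterval => joinPoint a.1 a.2 := by
  refine stdSimplex.continuous_segmentPoint.comp
    (Continuous.prodMk (Continuous.prodMk ?_ ?_) continuous_snd)
  · exact (stdSimplex.continuous_map _).comp continuous_fst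
  · exact (stdSimplex.continuous_map _).comp continuous_fst

theorem map_joinMap_joinPoint {n m : SimplexCategory} (f : n ⟶ m) (t : TopSimplex n)
    (s : unitInterval) :
    stdSimplex.map (joinMap f) (joinPoint t s) = joinPoint (stdSimplex.map f t) s := by
  have hl := congrArg (fun φ : n ⟶ SimplexCategory.mk (m.len + 1 + m.len) =>
    ⇑(ConcreteCategory.hom φ)) (joinLeft_comp_joinMap f)
  have hr := congrArg (fun φ : n ⟶ SimplexCategory.mk (m.len + 1 + m.len) =>
    ⇑(ConcreteCategory.hom φ)) (joinRight_comp_joinMap f)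
  simp only [joinPoint, stdSimplex.map_segmentPoint, stdSimplex.map_comp_apply]
  exact congrArg₂ (fun a b => stdSimplex.segmentPoint (stdSimplex.map a t)
    (stdSimplex.map b t) s) hl hr

end JoinPoint

/-! ### Natural transformations induce homotopies. -/

section Homotopy

variable {C D : Type u} [Category.{v} C] [Category.{v} D] [IsGroupoid D] {F G : C ⥤ D}

/-- The maps on topological simplices that constitute the homotopy between the maps of classifying
spaces induced by two functors. -/
noncomputable def homotopyCocone (α : F ⟶ G) :
    SSet.RealizationCocone (nerve C) C(unitInterval, ClassifyingSpace D) where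
  toFun {n} x := (⟨fun a : TopSimplex n × unitInterval =>
    SSet.realize (X := nerve D) (n := SimplexCategory.mk (n.len + 1 + n.len)) (joinArrows α x)
      (joinPoint a.1 a.2), (map_continuous _).comp continuous_joinPoint⟩ :
        C(TopSimplex n × unitInterval, ClassifyingSpace D)).curry
  map {n m} f x t := by
    ext s
    change SSet.realize (X := nerve D) (n := SimplexCategory.mk (n.len + 1 + n.len))
        (joinArrows α ((nerve C).map f.op x)) (joinPoint t s) =
      SSet.realize (X := nerve D) (n := SimplexCategory.mk (m.len + 1 + m.len)) (joinArrows α x)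
        (joinPoint (stdSimplex.map f t) s)
    rw [← nerve_map_joinMap_joinArrows, ← map_joinMap_joinPoint]
    exact SSet.realize_map (X := nerve D) (joinMap f) (joinArrows α x) (joinPoint t s)

/-- Functors to a groupoid that are related by a natural transformation induce homotopic maps of
classifying spaces. -/
theorem classifyingSpaceMap_homotopic (α : F ⟶ G) :
    (classifyingSpaceMap F).hom.Homotopic (classifyingSpaceMap G).hom := by
  let H := (homotopyCocone α).desc
  refine ⟨⟨⟨fun a => H a.2 a.1, ?_⟩, fun p => ?_, fun p => ?_⟩⟩
  -- The cocone takes values in paths, so joint continuity comes from local compactness of the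
  -- interval; realization need not be commuted with products.
  · exact (ContinuousMap.continuous_uncurry_of_continuous H).comp continuous_swap
  · obtain ⟨n, x, t, rfl⟩ := SSet.exists_realize p
    refine (congrArg (· 0) ((homotopyCocone α).desc_realize x t)).trans ?_
    change SSet.realize (X := nerve D) (n := SimplexCategory.mk (n.len + 1 + n.len))
      (joinArrows α x) (joinPoint t 0) = _
    rw [joinPoint, stdSimplex.segmentPoint_zero]
    refine (SSet.realize_map (X := nerve D) (joinLeft n) (joinArrows α x) t).symm.trans ?_
    rw [nerve_map_joinLeft_joinArrows]
    exact (SSet.toTop_map_realize (nerveMap F) x t).symm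
  · obtain ⟨n, x, t, rfl⟩ := SSet.exists_realize p
    refine (congrArg (· 1) ((homotopyCocone α).desc_realize x t)).trans ?_
    change SSet.realize (X := nerve D) (n := SimplexCategory.mk (n.len + 1 + n.len))
      (joinArrows α x) (joinPoint t 1) = _
    rw [joinPoint, stdSimplex.segmentPoint_one]
    refine (SSet.realize_map (X := nerve D) (joinRight n) (joinArrows α x) t).symm.trans ?_
    rw [nerve_map_joinRight_joinArrows]
    exact (SSet.toTop_map_realize (nerveMap G) x t).symm

end Homotopy

/-! ### Functoriality, and equivalences of groupoids. -/

section Functoriality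

variable {C D E : Type u} [Category.{v} C] [Category.{v} D] [Category.{v} E]

theorem classifyingSpaceMap_id : (classifyingSpaceMap (𝟭 C)).hom = ContinuousMap.id _ := by
  have h : classifyingSpaceMap (𝟭 C) = 𝟙 _ := SSet.toTop.map_id (nerve C)
  rw [h]
  rfl

theorem classifyingSpaceMap_comp (F : C ⥤ D) (G : D ⥤ E) :
    (classifyingSpaceMap (F ⋙ G)).hom =
      (classifyingSpaceMap G).hom.comp (classifyingSpaceMap F).hom := by
  have h : classifyingSpaceMap (F ⋙ G) = classifyingSpaceMap F ≫ classifyingSpaceMap G :=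
    SSet.toTop.map_comp (nerveMap F) (nerveMap G)
  rw [h]
  rfl

/-- A constant functor induces a constant map of classifying spaces. -/
theorem exists_classifyingSpaceMap_const_eq (d : D) :
    ∃ p, (classifyingSpaceMap ((Functor.const C).obj d)).hom = ContinuousMap.const _ p := by
  refine ⟨SSet.realize (X := nerve D) (n := SimplexCategory.mk 0) (ComposableArrows.mk₀ d)
    default, SSet.continuousMap_ext fun {n} x t => ?_⟩
  refine (SSet.toTop_map_realize (nerveMap ((Functor.const C).obj d)) x t).trans ?_
  -- The image simplex is pulled back from the vertex `d`, so its characteristic map factors through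
  -- a point.
  refine (SSet.realize_map (X := nerve D) (SimplexCategory.const n (SimplexCategory.mk 0) 0)
    (ComposableArrows.mk₀ d) t).trans ?_
  exact congrArg _ (Subsingleton.elim _ _)

/-- An equivalence of groupoids induces a homotopy equivalence of classifying spaces. -/
noncomputable def classifyingSpaceHomotopyEquiv [IsGroupoid C] [IsGroupoid D] (e : C ≌ D) :
    ContinuousMap.HomotopyEquiv (ClassifyingSpace C) (ClassifyingSpace D) where
  toFun := (classifyingSpaceMap e.functor).hom
  invFun := (classifyingSpaceMap e.inverse).hom
  left_inv := by
    rw [← classifyingSpaceMap_comp, ← classifyingSpaceMap_id]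
    exact classifyingSpaceMap_homotopic e.unitIso.inv
  right_inv := by
    rw [← classifyingSpaceMap_comp, ← classifyingSpaceMap_id]
    exact classifyingSpaceMap_homotopic e.counitIso.hom

end Functoriality

/-! ### Decomposition over the conjugacy classes. -/

namespace AdjointGroupoid

variable {G : Type u} [Group G]

theorem inClass_of_hom {c : ConjClasses G} {a b : AdjointGroupoid G} (f : a ⟶ b)
    (h : inClass c a) : inClass c b := by
  refine Eq.trans (ConjClasses.mk_eq_mk_iff_isConj.2 ?_) h
  exact (isConj_iff.2 ⟨f.1, f.2⟩).symm

/-- The conjugacy class that contains all vertices of a simplex. -/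
def simplexClass {n : SimplexCategory} (x : (nerve (AdjointGroupoid G)).obj (op n)) :
    ConjClasses G :=
  ConjClasses.mk (x.obj 0).elt

theorem inClass_simplexClass {n : SimplexCategory} (x : (nerve (AdjointGroupoid G)).obj (op n))
    (i : Fin (n.len + 1)) : inClass (simplexClass x) (x.obj i) :=
  inClass_of_hom (x.map (homOfLE (Fin.zero_le i))) rfl

/-- A simplex with vertices in a conjugacy class, as a simplex of the full subgroupoid. -/
def simplexLift (c : ConjClasses G) {n : SimplexCategory}
    (x : (nerve (AdjointGroupoid G)).obj (op n)) (h : ∀ i, inClass c (x.obj i)) :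
    (nerve (Component c)).obj (op n) :=
  (inClass c).lift x h

/-- Needed because `simplexClass` reads the vertex 0, which a simplicial operator may replace by
another vertex: the index of the summand is then only propositionally the same. -/
theorem sigma_realize_simplexLift_congr {c d : ConjClasses G} (hcd : c = d) {n : SimplexCategory}
    (x : (nerve (AdjointGroupoid G)).obj (op n)) (hc : ∀ i, inClass c (x.obj i))
    (hd : ∀ i, inClass d (x.obj i)) (t : TopSimplex n) :
    (⟨c, SSet.realize (simplexLift c x hc) t⟩ :
      Σ c : ConjClasses G, ClassifyingSpace (Component c)) =
      ⟨d, SSet.realize (simplexLift d x hd) t⟩ := by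
  subst hcd
  rfl

/-- The maps on topological simplices that constitute the inverse of `fromCoproduct`. -/
noncomputable def toCoproductCocone (G : Type u) [Group G] :
    SSet.RealizationCocone (nerve (AdjointGroupoid G))
      (Σ c : ConjClasses G, ClassifyingSpace (Component c)) where
  toFun x := ⟨fun t => ⟨simplexClass x,
    SSet.realize (simplexLift (simplexClass x) x (inClass_simplexClass x)) t⟩,
    continuous_sigmaMk.comp (map_continuous _)⟩
  map {n m} f x t := by
    refine (sigma_realize_simplexLift_congr (d := simplexClass x) ?_ _ _
      (fun i => inClass_simplexClass x (f i)) t).trans ?_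
    · exact inClass_simplexClass x (f 0)
    · exact congrArg (Sigma.mk (simplexClass x)) (SSet.realize_map (X := nerve (Component _)) f
        (simplexLift (simplexClass x) x (inClass_simplexClass x)) t)

theorem isHomeomorph_fromCoproduct (G : Type u) [Group G] : IsHomeomorph (fromCoproduct G) := by
  let e : (Σ c : ConjClasses G, ClassifyingSpace (Component c)) ≃ₜ
      ClassifyingSpace (AdjointGroupoid G) :=
    { toFun := fromCoproduct G
      invFun := (toCoproductCocone G).desc
      left_inv := by
        rintro ⟨c, p⟩
        obtain ⟨n, x, t, rfl⟩ := SSet.exists_realize p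
        refine (congrArg (toCoproductCocone G).desc
          (SSet.toTop_map_realize (nerveMap (inClass c).ι) x t)).trans ?_
        refine ((toCoproductCocone G).desc_realize _ t).trans ?_
        exact sigma_realize_simplexLift_congr (x.obj 0).property _ _
          (fun i => (x.obj i).property) t
      right_inv := by
        intro p
        obtain ⟨n, x, t, rfl⟩ := SSet.exists_realize p
        refine (congrArg (fromCoproduct G) ((toCoproductCocone G).desc_realize x t)).trans ?_
        exact SSet.toTop_map_realize (nerveMap (inClass _).ι) _ t
      continuous_toFun := continuous_sigma fun c =>
        (classifyingSpaceMap (inClass c).ι).hom.continuous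
      continuous_invFun := map_continuous _ }
  exact e.isHomeomorph

end AdjointGroupoid

/-! ### The component of `g` as an orbit space. -/

namespace AdjointGroupoid

variable {G : Type u} [Group G]

/-- The group element that underlies a morphism of the subgroupoid of a conjugacy class. -/
def Component.val {c : ConjClasses G} {a b : Component c} (f : a ⟶ b) : G := f.hom.1

theorem Component.val_comp {c : ConjClasses G} {a b d : Component c} (f : a ⟶ b) (f' : b ⟶ d) :
    val (f ≫ f') = val f' * val f := rfl

theorem Component.val_eqToHom {c : ConjClasses G} {a b : Component c} (h : a = b) :
    val (eqToHom h) = 1 := by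
  subst h
  rfl

theorem Component.val_injective {c : ConjClasses G} {a b : Component c} {f f' : a ⟶ b}
    (h : val f = val f') : f = f' :=
  ObjectProperty.hom_ext _ (Subtype.ext h)

theorem Component.conj_val {c : ConjClasses G} {a b : Component c} (f : a ⟶ b) :
    val f * a.obj.elt * (val f)⁻¹ = b.obj.elt := f.hom.2

end AdjointGroupoid

namespace RightGroupoid

open AdjointGroupoid

variable {G : Type u} [Group G]

/-- The functor from the right action groupoid to the subgroupoid of the conjugacy class of `g`
that sends `a` to `a⁻¹ * g * a`. -/
def toComponent (g : G) : RightGroupoid G ⥤ Component (ConjClasses.mk g) where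
  obj a := ⟨⟨a.elt⁻¹ * g * a.elt⟩, ConjClasses.mk_eq_mk_iff_isConj.2
    (isConj_iff.2 ⟨a.elt, by group⟩)⟩
  -- Inversion reconciles the opposite composition orders of the two groupoids.
  map {a b} x := ObjectProperty.homMk ⟨x.1⁻¹, by
    have key : ∀ p q r : G, p * q = r → q⁻¹ * (p⁻¹ * g * p) * q⁻¹⁻¹ = r⁻¹ * g * r := by
      rintro p q _ rfl
      group
    exact key _ _ _ x.2⟩
  map_id a := Component.val_injective (inv_one : (1 : G)⁻¹ = 1)
  map_comp x y := Component.val_injective (mul_inv_rev x.1 y.1)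

/-- Any `a` that conjugates the first vertex to `g` is a lift of that vertex. The arrows then force
the other vertices: if `v` leads from vertex 0 to vertex `i`, the lift is `a * v⁻¹`. -/
theorem exists_toComponent_lift (g : G) {n : SimplexCategory}
    (y : (nerve (Component (ConjClasses.mk g))).obj (op n)) :
    ∃ x : (nerve (RightGroupoid G)).obj (op n), (nerveMap (toComponent g)).app (op n) x = y := by
  obtain ⟨a, ha⟩ := isConj_iff.1 (ConjClasses.mk_eq_mk_iff_isConj.1 (y.obj 0).property)
  let o (i : Fin (n.len + 1)) : y.obj 0 ⟶ y.obj i := y.map (homOfLE (Fin.zero_le i))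
  have ho {i j : Fin (n.len + 1)} (f : i ⟶ j) :
      Component.val (o j) = Component.val (y.map f) * Component.val (o i) := by
    rw [← Component.val_comp]
    exact congrArg Component.val (y.map_comp _ _)
  let x : Fin (n.len + 1) ⥤ RightGroupoid G :=
    { obj i := ⟨a * (Component.val (o i))⁻¹⟩
      map {i j} f := ⟨(Component.val (y.map f))⁻¹, by
        simp only [ho f, mul_inv_rev, mul_assoc]⟩
      map_id _ := Subsingleton.elim _ _
      map_comp _ _ := Subsingleton.elim _ _ }
  refine ⟨x, ?_⟩
  have hobj (i : Fin (n.len + 1)) : (toComponent g).obj (x.obj i) = y.obj i := by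
    refine ObjectProperty.FullSubcategory.ext (AdjointGroupoid.ext ?_)
    have key : ∀ e v k : G, a * e * a⁻¹ = k → (a * v⁻¹)⁻¹ * k * (a * v⁻¹) = v * e * v⁻¹ := by
      rintro e v _ rfl
      group
    exact (key _ _ _ ha).trans (Component.conj_val (o i))
  refine CategoryTheory.Functor.ext (F := x ⋙ toComponent g) hobj fun i j f => ?_
  apply Component.val_injective
  rw [Component.val_comp, Component.val_comp, Component.val_eqToHom, Component.val_eqToHom]
  change (Component.val (y.map f))⁻¹⁻¹ = _
  simp

theorem exists_leftTranslation_of_toComponent_eq (g : G) {n : SimplexCategory}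
    {x y : (nerve (RightGroupoid G)).obj (op n)}
    (h : (nerveMap (toComponent g)).app (op n) x = (nerveMap (toComponent g)).app (op n) y) :
    ∃ k ∈ Subgroup.centralizer {g}, (nerveMap (leftTranslation k)).app (op n) x = y := by
  have h' : (x ⋙ toComponent g : Fin (n.len + 1) ⥤ _) = y ⋙ toComponent g := h
  have h0 : (x.obj 0).elt⁻¹ * g * (x.obj 0).elt = (y.obj 0).elt⁻¹ * g * (y.obj 0).elt :=
    congrArg (fun z : Component (ConjClasses.mk g) => z.obj.elt) (Functor.congr_obj h' 0)
  have hx (z : (nerve (RightGroupoid G)).obj (op n)) (i : Fin (n.len + 1)) :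
    (z.obj 0).elt * (z.map (homOfLE (Fin.zero_le i))).1 = (z.obj i).elt :=
      (z.map (homOfLE (Fin.zero_le i))).2
  have hm (i : Fin (n.len + 1)) : (x.map (homOfLE (Fin.zero_le i))).1 =
      (y.map (homOfLE (Fin.zero_le i))).1 := by
    have := congrArg Component.val (Functor.congr_hom h' (homOfLE (Fin.zero_le i)))
    rw [Component.val_comp, Component.val_comp, Component.val_eqToHom, Component.val_eqToHom,
      one_mul, mul_one] at this
    exact inv_injective this
  -- This is the only translation matching the first vertices; since the arrows of both strings have
  -- the same underlying elements, it matches all vertices. It centralizes `g` because both first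
  -- vertices conjugate `g` to the same element.
  refine ⟨(y.obj 0).elt * (x.obj 0).elt⁻¹, ?_, ?_⟩
  · rw [Subgroup.mem_centralizer_singleton_iff]
    have := congrArg (fun z => (y.obj 0).elt * z * (x.obj 0).elt⁻¹) h0
    simpa [mul_assoc] using this
  · refine nerve.ext_of_isThin (funext fun i => RightGroupoid.ext ?_)
    have key : ∀ p q m r s : G, p * m = r → q * m = s → q * p⁻¹ * r = s := by
      rintro p q m _ _ rfl rfl
      group
    exact key _ _ _ _ _ (hx x i) ((congrArg _ (hm i)).trans (hx y i))

/-- Makes the choice of lift in `toOrbitSpaceCocone` immaterial. -/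
theorem mk_realize_eq_of_toComponent_eq (g : G) {n : SimplexCategory}
    {x y : (nerve (RightGroupoid G)).obj (op n)}
    (h : (nerveMap (toComponent g)).app (op n) x = (nerveMap (toComponent g)).app (op n) y)
    (t : TopSimplex n) :
    (Quotient.mk _ (SSet.realize x t) : MulAction.orbitRel.Quotient (Subgroup.centralizer {g})
      (ClassifyingSpace (RightGroupoid G))) = Quotient.mk _ (SSet.realize y t) := by
  obtain ⟨k, hk, rfl⟩ := exists_leftTranslation_of_toComponent_eq g h
  refine (Quotient.sound (MulAction.orbitRel_apply.2 ⟨⟨k, hk⟩, ?_⟩)).symm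
  exact SSet.toTop_map_realize (nerveMap (leftTranslation k)) x t

theorem leftTranslation_comp_toComponent {g k : G} (hk : k ∈ Subgroup.centralizer {g}) :
    leftTranslation k ⋙ toComponent g = toComponent g := by
  rw [Subgroup.mem_centralizer_singleton_iff] at hk
  have hk' : k⁻¹ * g * k = g := by rw [mul_assoc, ← hk, inv_mul_cancel_left]
  refine CategoryTheory.Functor.ext (fun a => ?_) fun a b f => ?_
  · refine ObjectProperty.FullSubcategory.ext (AdjointGroupoid.ext ?_)
    change (k * a.elt)⁻¹ * g * (k * a.elt) = a.elt⁻¹ * g * a.elt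
    conv_rhs => rw [← hk']
    group
  · apply Component.val_injective
    rw [Component.val_comp, Component.val_comp, Component.val_eqToHom, Component.val_eqToHom,
      one_mul, mul_one]
    rfl

/-- The maps on topological simplices that constitute the map from the classifying space of the
subgroupoid of a conjugacy class to the orbit space. -/
noncomputable def toOrbitSpaceCocone (g : G) :
    SSet.RealizationCocone (nerve (Component (ConjClasses.mk g)))
      (MulAction.orbitRel.Quotient (Subgroup.centralizer {g})
        (ClassifyingSpace (RightGroupoid G))) where
  toFun y := ⟨fun t => Quotient.mk _ (SSet.realize (exists_toComponent_lift g y).choose t),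
    continuous_quotient_mk'.comp (map_continuous _)⟩
  map {n m} f y t := by
    refine Eq.trans ?_ (congrArg (Quotient.mk _) (SSet.realize_map (X := nerve (RightGroupoid G)) f
      (exists_toComponent_lift g y).choose t))
    refine mk_realize_eq_of_toComponent_eq g ?_ t
    refine (exists_toComponent_lift g _).choose_spec.trans ?_
    exact congrArg ((nerve (Component (ConjClasses.mk g))).map f.op)
      (exists_toComponent_lift g y).choose_spec.symm

/-- The classifying space of the subgroupoid of the conjugacy class of `g` is the orbit space of
the action of the centralizer of `g` on the classifying space of the right action groupoid. -/
noncomputable def orbitSpaceHomeomorph (g : G) :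
    MulAction.orbitRel.Quotient (Subgroup.centralizer {g})
      (ClassifyingSpace (RightGroupoid G)) ≃ₜ
        ClassifyingSpace (Component (ConjClasses.mk g)) where
  toFun := Quotient.lift (classifyingSpaceMap (toComponent g)).hom (by
    rintro _ q ⟨⟨k, hk⟩, rfl⟩
    change (classifyingSpaceMap (toComponent g)).hom
      ((classifyingSpaceMap (leftTranslation k)).hom q) = _
    rw [← ContinuousMap.comp_apply, ← classifyingSpaceMap_comp,
      leftTranslation_comp_toComponent hk])
  invFun := (toOrbitSpaceCocone g).desc
  left_inv := by
    rintro ⟨p⟩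
    obtain ⟨n, x, t, rfl⟩ := SSet.exists_realize p
    refine (congrArg (toOrbitSpaceCocone g).desc
      (SSet.toTop_map_realize (nerveMap (toComponent g)) x t)).trans ?_
    refine ((toOrbitSpaceCocone g).desc_realize _ t).trans ?_
    exact mk_realize_eq_of_toComponent_eq g (exists_toComponent_lift g _).choose_spec t
  right_inv := by
    intro p
    obtain ⟨n, x, t, rfl⟩ := SSet.exists_realize p
    rw [(toOrbitSpaceCocone g).desc_realize x t]
    refine (SSet.toTop_map_realize (nerveMap (toComponent g)) _ t).trans ?_
    rw [(exists_toComponent_lift g x).choose_spec]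
  continuous_toFun := Continuous.quotient_lift (map_continuous _) _
  continuous_invFun := map_continuous _

end RightGroupoid

/-! ### Step functions and convergence in measure. -/

section StepFunctions

open MeasureTheory

/-- Functions from the half-open unit interval to a type, with the pseudometric that measures
the set where two functions differ. -/
def LabelFunction (G : Type u) : Type u := Set.Ico (0 : ℝ) 1 → G

/-- Monotonicity and subadditivity of the outer measure suffice for the triangle inequality, so
arbitrary functions are allowed. -/
noncomputable instance (G : Type u) : PseudoEMetricSpace (LabelFunction G) where
  edist f g := volume (Subtype.val '' {s : Set.Ico (0 : ℝ) 1 | f s ≠ g s})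
  edist_self f := by simp
  edist_comm f g := by simp only [ne_comm]
  edist_triangle f g h := by
    refine (measure_mono ?_).trans (measure_union_le _ _)
    rw [← Set.image_union]
    refine Set.image_mono fun s hs => ?_
    by_contra! hc
    simp only [Set.mem_union, Set.mem_ofPred_eq, not_or, not_not] at hc
    exact hs (hc.1.trans hc.2)

theorem LabelFunction.edist_def {G : Type u} (f g : LabelFunction G) :
    edist f g = volume (Subtype.val '' {s : Set.Ico (0 : ℝ) 1 | f s ≠ g s}) := rfl

theorem LabelFunction.edist_eq_one {G : Type u} {f g : LabelFunction G} (h : ∀ s, f s ≠ g s) :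
    edist f g = 1 := by
  have hu : {s : Set.Ico (0 : ℝ) 1 | f s ≠ g s} = Set.univ := Set.eq_univ_of_forall h
  rw [LabelFunction.edist_def, hu, Set.image_univ, Subtype.range_val, Real.volume_Ico]
  simp

namespace stdSimplex

variable {n m : ℕ}

/-- The sum of the first barycentric coordinates of a point of a simplex. -/
noncomputable def partialSum (t : stdSimplex ℝ (Fin (n + 1))) (i : Fin (n + 1)) : ℝ :=
  ∑ j ∈ Finset.Iic i, t j

theorem partialSum_mono (t : stdSimplex ℝ (Fin (n + 1))) : Monotone (partialSum t) :=
  fun _ _ h => Finset.sum_le_sum_of_subset_of_nonneg (Finset.Iic_subset_Iic.2 h)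
    fun _ _ _ => zero_le t _

theorem partialSum_last (t : stdSimplex ℝ (Fin (n + 1))) : partialSum t (Fin.last n) = 1 := by
  rw [← sum_eq_one t, partialSum]
  congr 1
  ext i
  simp [Fin.le_last]

theorem continuous_partialSum (i : Fin (n + 1)) :
    Continuous fun t : stdSimplex ℝ (Fin (n + 1)) => partialSum t i :=
  continuous_finsetSum _ fun j _ => (continuous_apply j).comp continuous_subtype_val

/-- The least index whose partial sum exceeds `s`; it exists because the last partial sum is 1 and
`s < 1`. -/
theorem exists_le_iff_lt_partialSum (t : stdSimplex ℝ (Fin (n + 1))) (s : Set.Ico (0 : ℝ) 1) :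
    ∃ i, ∀ j, i ≤ j ↔ s.1 < partialSum t j := by
  classical
  have hne : (Finset.univ.filter fun j => s.1 < partialSum t j).Nonempty :=
    ⟨Fin.last n, by simpa [partialSum_last] using s.2.2⟩
  refine ⟨Finset.min' _ hne, fun j => ⟨fun h => ?_, fun h => Finset.min'_le _ _ (by simpa)⟩⟩
  have := Finset.min'_mem _ hne
  simp only [Finset.mem_filter, Finset.mem_univ, true_and] at this
  exact this.trans_le (partialSum_mono t h)

/-- The index of the subinterval that contains `s`, when the unit interval is subdivided into
intervals whose lengths are the barycentric coordinates of `t`. -/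
noncomputable def index (t : stdSimplex ℝ (Fin (n + 1))) (s : Set.Ico (0 : ℝ) 1) : Fin (n + 1) :=
  (exists_le_iff_lt_partialSum t s).choose

theorem index_le_iff {t : stdSimplex ℝ (Fin (n + 1))} {s : Set.Ico (0 : ℝ) 1} {j : Fin (n + 1)} :
    index t s ≤ j ↔ s.1 < partialSum t j :=
  (exists_le_iff_lt_partialSum t s).choose_spec j

theorem partialSum_map (f : Fin (n + 1) → Fin (m + 1)) (t : stdSimplex ℝ (Fin (n + 1)))
    (j : Fin (m + 1)) : partialSum (map f t) j = ∑ i with f i ≤ j, t i := by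
  classical
  simp only [partialSum, map_coe, FunOnFinite.linearMap_apply_apply]
  rw [Finset.sum_fiberwise_eq_sum_filter]
  simp

/-- For monotone `f` the indices with `f i ≤ j` form an initial segment, so a partial sum of the
image is a partial sum of `t`, or an empty sum, which `0 ≤ s` excludes. This is what makes step
functions compatible with faces and degeneracies. -/
theorem index_map {f : Fin (n + 1) → Fin (m + 1)} (hf : Monotone f)
    (t : stdSimplex ℝ (Fin (n + 1))) (s : Set.Ico (0 : ℝ) 1) :
    index (map f t) s = f (index t s) := by
  refine eq_of_forall_ge_iff fun j => ?_
  rw [index_le_iff, partialSum_map]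
  constructor
  · intro h
    have hne : (Finset.univ.filter fun i => f i ≤ j).Nonempty := by
      by_contra hc
      rw [Finset.not_nonempty_iff_eq_empty] at hc
      rw [hc, Finset.sum_empty] at h
      exact absurd s.2.1 (not_le.2 h)
    have hmem := Finset.max'_mem _ hne
    simp only [Finset.mem_filter, Finset.mem_univ, true_and] at hmem
    refine (hf (index_le_iff.2 (h.trans_le ?_))).trans hmem
    refine Finset.sum_le_sum_of_subset_of_nonneg (fun i hi => ?_) fun _ _ _ => zero_le t _
    exact Finset.mem_Iic.2 (Finset.le_max' _ _ hi)
  · intro h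
    refine (index_le_iff (t := t).1 le_rfl).trans_le ?_
    refine Finset.sum_le_sum_of_subset_of_nonneg (fun i hi => ?_) fun _ _ _ => zero_le t _
    simpa using (hf (Finset.mem_Iic.1 hi)).trans h

/-- The step function with given values on the subdivision that belongs to a point of a simplex. -/
noncomputable def label {G : Type u} (a : Fin (n + 1) → G) (t : stdSimplex ℝ (Fin (n + 1))) :
    LabelFunction G :=
  fun s => a (index t s)

/-- If the labels differ at `s`, then so do the indices, and at the smaller index the point `s` lies
between the two corresponding breakpoints. -/
theorem edist_label_le {G : Type u} (a : Fin (n + 1) → G) (t t' : stdSimplex ℝ (Fin (n + 1))) :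
    edist (label a t) (label a t') ≤ ∑ j, edist (partialSum t j) (partialSum t' j) := by
  have hsub : Subtype.val '' {s : Set.Ico (0 : ℝ) 1 | label a t s ≠ label a t' s} ⊆
      ⋃ j ∈ (Finset.univ : Finset (Fin (n + 1))),
        Set.uIcc (partialSum t j) (partialSum t' j) := by
    rintro _ ⟨s, hs, rfl⟩
    have hne : index t s ≠ index t' s := fun h => hs (congrArg a h)
    simp only [Finset.mem_univ, Set.iUnion_true, Set.mem_iUnion]
    rcases lt_or_gt_of_ne hne with h | h
    · refine ⟨index t s, Set.mem_uIcc.2 (Or.inr ⟨?_, (index_le_iff.1 le_rfl).le⟩)⟩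
      exact not_lt.1 fun h' => not_le.2 h (index_le_iff.2 h')
    · refine ⟨index t' s, Set.mem_uIcc.2 (Or.inl ⟨?_, (index_le_iff.1 le_rfl).le⟩)⟩
      exact not_lt.1 fun h' => not_le.2 h (index_le_iff.2 h')
  refine (measure_mono hsub).trans ((measure_biUnion_finset_le _ _).trans
    (Finset.sum_le_sum fun j _ => ?_))
  rw [Real.volume_interval, edist_comm, edist_dist, Real.dist_eq]

theorem continuous_label {G : Type u} (a : Fin (n + 1) → G) : Continuous (label a) := by
  refine continuous_iff_continuousAt.2 fun t => ?_
  rw [ContinuousAt, tendsto_iff_edist_tendsto_0]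
  refine tendsto_of_tendsto_of_tendsto_of_le_of_le tendsto_const_nhds ?_
    (fun _ => bot_le) fun t' => edist_label_le a t' t
  rw [← Finset.sum_const_zero (ι := Fin (n + 1)) (s := Finset.univ)]
  refine tendsto_finsetSum _ fun j _ => ?_
  exact tendsto_iff_edist_tendsto_0.1 (continuous_partialSum j).continuousAt

end stdSimplex

end StepFunctions

/-! ### The translation action is a covering action on a contractible space. -/

namespace RightGroupoid

variable {G : Type u} [Group G]

/-- The step functions that belong to the points of the topological simplices. -/
noncomputable def labelCocone (G : Type u) [Group G] :
    SSet.RealizationCocone (nerve (RightGroupoid G)) (LabelFunction G) where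
  toFun {n} x := ⟨stdSimplex.label fun i : Fin (n.len + 1) => (x.obj i).elt,
    stdSimplex.continuous_label _⟩
  map {_ m} f x t := funext fun s =>
    (congrArg (fun i : Fin (m.len + 1) => (x.obj i).elt)
      (stdSimplex.index_map (SimplexCategory.Hom.toOrderHom f).monotone t s)).symm

/-- The step function that belongs to a point of the classifying space. -/
noncomputable def labelMap (G : Type u) [Group G] :
    C(ClassifyingSpace (RightGroupoid G), LabelFunction G) :=
  (labelCocone G).desc

theorem labelMap_smul (h : G) (p : ClassifyingSpace (RightGroupoid G)) (s : Set.Ico (0 : ℝ) 1) :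
    labelMap G (h • p) s = h * labelMap G p s := by
  obtain ⟨n, x, t, rfl⟩ := SSet.exists_realize p
  have h₁ : h • SSet.realize x t =
      SSet.realize ((nerveMap (leftTranslation h)).app (op n) x) t :=
    SSet.toTop_map_realize (nerveMap (leftTranslation h)) x t
  rw [h₁]
  exact (congrFun ((labelCocone G).desc_realize _ t) s).trans
    (congrArg (h * ·) (congrFun ((labelCocone G).desc_realize x t) s).symm)

/-- For `h ≠ 1` the labels of `q` and `h • q` differ everywhere, so they are at distance 1 and
cannot both lie in an open ball of radius 1/2. -/
theorem exists_nhds_forall_smul_disjoint (p : ClassifyingSpace (RightGroupoid G)) :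
    ∃ U ∈ nhds p, ∀ h : G, ((h • ·) '' U ∩ U).Nonempty → h = 1 := by
  refine ⟨labelMap G ⁻¹' Metric.eball (labelMap G p) 2⁻¹,
    (labelMap G).continuous.continuousAt (Metric.eball_mem_nhds _ (by simp)), ?_⟩
  rintro h ⟨_, ⟨q, hq, rfl⟩, hq'⟩
  by_contra hh
  have h1 : edist (labelMap G (h • q)) (labelMap G q) = 1 :=
    LabelFunction.edist_eq_one fun s => by
      rw [labelMap_smul]
      simpa using hh
  have h2 := (edist_triangle_right (labelMap G (h • q)) (labelMap G q) (labelMap G p)).trans_lt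
    (ENNReal.add_lt_add hq' hq)
  rw [h1, ENNReal.inv_two_add_inv_two] at h2
  exact lt_irrefl _ h2

instance : ContinuousConstSMul G (ClassifyingSpace (RightGroupoid G)) where
  continuous_const_smul h := (classifyingSpaceMap (leftTranslation h)).hom.continuous

theorem isQuotientCoveringMap_orbitSpaceHomeomorph (g : G) :
    IsQuotientCoveringMap
      (orbitSpaceHomeomorph g ∘
        (Quotient.mk (MulAction.orbitRel (Subgroup.centralizer {g})
          (ClassifyingSpace (RightGroupoid G))))) (Subgroup.centralizer {g}) := by
  refine IsQuotientCoveringMap.homeomorph_comp ?_ (orbitSpaceHomeomorph g)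
  exact
    { toIsQuotientMap := isQuotientMap_quotient_mk'
      continuous_const_smul := fun h => continuous_const_smul (h : G)
      apply_eq_iff_mem_orbit := Quotient.eq
      disjoint := fun p => by
        obtain ⟨U, hU, h⟩ := exists_nhds_forall_smul_disjoint p
        exact ⟨U, hU, fun k hk => Subtype.ext (h k hk)⟩ }

/-- The object 1 is terminal, which gives a natural transformation from the identity to a constant
functor. -/
instance : ContractibleSpace (ClassifyingSpace (RightGroupoid G)) := by
  let α : 𝟭 (RightGroupoid G) ⟶ (Functor.const _).obj ⟨1⟩ :=
    { app a := ⟨a.elt⁻¹, mul_inv_cancel a.elt⟩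
      naturality _ _ _ := Subsingleton.elim _ _ }
  obtain ⟨p, hp⟩ := exists_classifyingSpaceMap_const_eq (C := RightGroupoid G)
    (D := RightGroupoid G) ⟨1⟩
  rw [contractible_iff_id_nullhomotopic]
  refine ⟨p, ?_⟩
  rw [← hp, ← classifyingSpaceMap_id]
  exact classifyingSpaceMap_homotopic α

end RightGroupoid

open scoped unitInterval Topology.Homotopy

/-! ### Homotopy groups of the base of a covering with contractible total space. -/

section HigherHomotopy

variable {N : Type*} {X : Type*} [TopologicalSpace X] {x : X}

theorem GenLoop.homotopic_of_map {f g : Ω^ N X x} (K : C(I × (N → I), X))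
    (h₀ : ∀ y, K (0, y) = f y) (h₁ : ∀ y, K (1, y) = g y)
    (hb : ∀ s, ∀ y ∈ Cube.boundary N, K (s, y) = x) : GenLoop.Homotopic f g :=
  ⟨{  toContinuousMap := K
      map_zero_left := h₀
      map_one_left := h₁
      prop' := fun s y hy => (hb s y hy).trans (GenLoop.boundary f y hy).symm }⟩

/-- The map of the unit interval that stretches the middle half. -/
noncomputable def stretch (r : I) : I := Set.projIcc 0 1 zero_le_one (2 * (r : ℝ) - 1 / 2)

/-- The function on the unit interval that vanishes at the end points and is `1` on the middle
half. -/
noncomputable def bump (r : I) : I := Set.projIcc 0 1 zero_le_one (4 * min (r : ℝ) (1 - r))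

theorem continuous_stretch : Continuous stretch :=
  continuous_projIcc.comp (by fun_prop)

theorem continuous_bump : Continuous bump :=
  continuous_projIcc.comp (by fun_prop)

theorem stretch_zero : stretch 0 = 0 := Set.projIcc_of_le_left _ (by norm_num)

theorem stretch_one : stretch 1 = 1 := Set.projIcc_of_right_le _ (by norm_num)

theorem bump_zero : bump 0 = 0 := Set.projIcc_of_le_left _ (by norm_num)

theorem bump_one : bump 1 = 0 := Set.projIcc_of_le_left _ (by norm_num)

/-- Where the bump is not yet 1, a stretched loop already sits at its base point. -/
theorem stretch_eq_of_bump_ne_one {r : I} (h : bump r ≠ 1) : stretch r = 0 ∨ stretch r = 1 := by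
  by_contra! hc
  apply h
  apply Set.projIcc_of_right_le
  have h0 : 0 < 2 * (r : ℝ) - 1 / 2 := not_le.1 fun h' => hc.1 (Set.projIcc_of_le_left _ h')
  have h1 : 2 * (r : ℝ) - 1 / 2 < 1 := not_le.1 fun h' => hc.2 (Set.projIcc_of_right_le _ h')
  rcases min_cases (r : ℝ) (1 - r) with h | h <;> rw [h.1] <;> linarith

/-- The linear homotopy from the identity to `stretch`. -/
noncomputable def stretchHomotopy (s r : I) : I :=
  ⟨(1 - (s : ℝ)) * r + s * stretch r,
    convex_Icc (0 : ℝ) 1 r.2 (stretch r).2 (sub_nonneg.2 s.2.2) s.2.1 (by ring)⟩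

theorem continuous_stretchHomotopy : Continuous fun a : I × I => stretchHomotopy a.1 a.2 := by
  have := continuous_stretch
  refine Continuous.subtype_mk ?_ _
  fun_prop

theorem stretchHomotopy_zero_left (r : I) : stretchHomotopy 0 r = r :=
  Subtype.ext (by simp [stretchHomotopy])

theorem stretchHomotopy_one_left (r : I) : stretchHomotopy 1 r = stretch r :=
  Subtype.ext (by simp [stretchHomotopy])

theorem stretchHomotopy_zero_right (s : I) : stretchHomotopy s 0 = 0 :=
  Subtype.ext (by simp [stretchHomotopy, stretch_zero])

theorem stretchHomotopy_one_right (s : I) : stretchHomotopy s 1 = 1 :=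
  Subtype.ext (by simp [stretchHomotopy, stretch_one])

/-- In dimension at least two the boundary of the cube is path connected: shrink all coordinates but
the extreme one `i` to 0, then shrink `i` while another coordinate `j` stays 0. Along both paths `F`
stays in one fibre, which is discrete. -/
theorem IsCoveringMap.apply_eq_of_mem_boundary {E : Type*} [TopologicalSpace E] [Nontrivial N]
    {p : E → X} (hp : IsCoveringMap p) (F : C(N → I, E))
    (hF : ∀ y ∈ Cube.boundary N, p (F y) = x) {y : N → I} (hy : y ∈ Cube.boundary N) :
    F y = F 0 := by
  classical
  obtain ⟨i, hi⟩ := hy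
  obtain ⟨j, hj⟩ := exists_ne i
  let k₁ : I → (N → I) := fun s l => if l = i then y i else s * y l
  let k₂ : I → (N → I) := fun s l => if l = i then s * y i else 0
  have hk₁ : Continuous k₁ := continuous_pi fun l => by
    by_cases h : l = i <;> simp only [k₁, h, if_true, if_false] <;> fun_prop
  have hk₂ : Continuous k₂ := continuous_pi fun l => by
    by_cases h : l = i <;> simp only [k₂, h, if_true, if_false] <;> fun_prop
  have hb₁ (s : I) : k₁ s ∈ Cube.boundary N := ⟨i, by simpa [k₁] using hi⟩
  have hb₂ (s : I) : k₂ s ∈ Cube.boundary N := ⟨j, by simp [k₂, hj]⟩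
  have e₁ := hp.const_of_comp (g := fun s => F (k₁ s)) (by fun_prop)
    (fun a b => (hF _ (hb₁ a)).trans (hF _ (hb₁ b)).symm) 1 0
  have e₂ := hp.const_of_comp (g := fun s => F (k₂ s)) (by fun_prop)
    (fun a b => (hF _ (hb₂ a)).trans (hF _ (hb₂ b)).symm) 1 0
  have h₁ : k₁ 1 = y := by
    ext l
    by_cases h : l = i <;> simp [k₁, h]
  have h₂ : k₁ 0 = k₂ 1 := by
    ext l
    by_cases h : l = i <;> simp [k₁, k₂, h]
  have h₃ : k₂ 0 = 0 := by
    ext l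
    by_cases h : l = i <;> simp [k₂, h]
  rw [← h₁, ← h₃]
  exact e₁.trans ((congrArg F h₂).trans e₂)

variable [Fintype N]

/-- Generalized loops in a contractible space are null-homotopic relative to the boundary. -/
theorem GenLoop.homotopic_const_of_contractible [ContractibleSpace X] (f : Ω^ N X x) :
    GenLoop.Homotopic f GenLoop.const := by
  obtain ⟨x₀, ⟨H⟩⟩ := id_nullhomotopic X
  have hs : Continuous fun y : N → I => (fun i => stretch (y i) : N → I) :=
    continuous_pi fun i => continuous_stretch.comp (continuous_apply i)
  have hsb {y : N → I} (hy : y ∈ Cube.boundary N) :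
      (fun i => stretch (y i) : N → I) ∈ Cube.boundary N := by
    obtain ⟨i, hi | hi⟩ := hy
    · exact ⟨i, Or.inl (by simp [hi, stretch_zero])⟩
    · exact ⟨i, Or.inr (by simp [hi, stretch_one])⟩
  let χ : C(N → I, I) := ⟨fun y => ∏ i, bump (y i),
    continuous_finsetProd _ fun i _ => continuous_bump.comp (continuous_apply i)⟩
  have hχb {y : N → I} (hy : y ∈ Cube.boundary N) : χ y = 0 := by
    obtain ⟨i, hi | hi⟩ := hy
    · exact Finset.prod_eq_zero (Finset.mem_univ i) (by rw [hi, bump_zero])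
    · exact Finset.prod_eq_zero (Finset.mem_univ i) (by rw [hi, bump_one])
  -- The contraction `H` may move the base point, so it is run only up to time `χ y`, which is 0 on
  -- the boundary. Where `χ y = 1` the value of `H` is constant; elsewhere the stretched loop is at
  -- `x`. So only the track of `x` remains.
  have hχ (y : N → I) : H (χ y, f fun i => stretch (y i)) = H (χ y, x) := by
    by_cases h : ∀ i, bump (y i) = 1
    · have : χ y = 1 := Finset.prod_eq_one fun i _ => h i
      simp [this]
    · push Not at h
      obtain ⟨i, hi⟩ := h
      rw [GenLoop.boundary f _ ⟨i, stretch_eq_of_bump_ne_one hi⟩]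
  let f₁ : Ω^ N X x := ⟨⟨fun y => f fun i => stretch (y i), (map_continuous f).comp hs⟩,
    fun y hy => GenLoop.boundary f _ (hsb hy)⟩
  let f₂ : Ω^ N X x := ⟨⟨fun y => H (χ y, x), by fun_prop⟩,
    fun y hy => by simp [hχb hy]⟩
  have hf : Homotopic f f₁ := by
    refine GenLoop.homotopic_of_map ⟨fun a => f fun i => stretchHomotopy a.1 (a.2 i), ?_⟩
      (fun y => ?_) (fun y => ?_) fun s y hy => ?_
    · refine (map_continuous f).comp (continuous_pi fun i => ?_)
      exact continuous_stretchHomotopy.comp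
        (continuous_fst.prodMk ((continuous_apply i).comp continuous_snd))
    · simp [stretchHomotopy_zero_left]
    · simp only [ContinuousMap.coe_mk, stretchHomotopy_one_left]
      rfl
    · refine GenLoop.boundary f _ ?_
      obtain ⟨i, hi | hi⟩ := hy
      · exact ⟨i, Or.inl (by simp [hi, stretchHomotopy_zero_right])⟩
      · exact ⟨i, Or.inr (by simp [hi, stretchHomotopy_one_right])⟩
  have hf₁ : Homotopic f₁ f₂ := by
    refine GenLoop.homotopic_of_map ⟨fun a => H (a.1 * χ a.2, f₁ a.2), ?_⟩
      (fun y => ?_) (fun y => ?_) fun s y hy => ?_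
    · have := map_continuous f₁
      fun_prop
    · simp
    · simp only [ContinuousMap.coe_mk, one_mul]
      exact hχ y
    · simp [hχb hy, GenLoop.boundary f₁ y hy]
  have hf₂ : Homotopic GenLoop.const f₂ := by
    refine GenLoop.homotopic_of_map ⟨fun a => H (a.1 * χ a.2, x), by fun_prop⟩
      (fun y => ?_) (fun y => ?_) fun s y hy => ?_
    · simp
    · simp only [ContinuousMap.coe_mk, one_mul]
      rfl
    · simp [hχb hy]
  exact (hf.trans hf₁).trans hf₂.symm

/-- Generalized loops of dimension at least two in the base of a covering with contractible total
space are null-homotopic relative to the boundary. -/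
theorem IsCoveringMap.genLoop_homotopic_const {E : Type*} [TopologicalSpace E] [Nontrivial N]
    [ContractibleSpace E] {p : E → X} (hp : IsCoveringMap p) (hs : Function.Surjective p)
    (f : Ω^ N X x) : GenLoop.Homotopic f GenLoop.const := by
  obtain ⟨e, rfl⟩ := hs x
  have h0 : (0 : N → I) ∈ Cube.boundary N := ⟨Classical.arbitrary N, Or.inl rfl⟩
  -- Scaling the cube from the origin joins a constant map to `f`, so homotopy lifting from a
  -- constant start yields a lift of `f` at time 1.
  let K : C(I × (N → I), X) := ⟨fun a => f fun i => a.1 * a.2 i,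
    (map_continuous f).comp (by fun_prop)⟩
  have hK : ∀ y : N → I, K (0, y) = p e := fun y => by
    rw [← GenLoop.boundary f 0 h0]
    exact congrArg f (funext fun i => zero_mul _)
  let F' := hp.liftHomotopy K (.const _ e) hK
  let F : C(N → I, E) := F'.comp ⟨fun y => (1, y), by fun_prop⟩
  have hF (y : N → I) : p (F y) = f y := by
    refine (congrFun (hp.liftHomotopy_lifts K (.const _ e) hK) (1, y)).trans ?_
    exact congrArg f (funext fun i => one_mul _)
  have hF' {y : N → I} (hy : y ∈ Cube.boundary N) : F y = F 0 :=
    hp.apply_eq_of_mem_boundary (x := p e) F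
      (fun z hz => (hF z).trans (GenLoop.boundary f z hz)) hy
  let L : Ω^ N E (F 0) := ⟨F, fun y hy => hF' hy⟩
  obtain ⟨H⟩ := GenLoop.homotopic_const_of_contractible L
  refine GenLoop.homotopic_of_map ⟨fun a => p (H a), hp.continuous.comp (map_continuous H)⟩
    (fun y => ?_) (fun y => ?_) fun s y hy => ?_
  · exact (congrArg p (H.apply_zero y)).trans (hF y)
  · exact (congrArg p (H.apply_one y)).trans ((hF 0).trans (GenLoop.boundary f 0 h0))
  · exact (congrArg p (H.eq_fst s hy)).trans ((hF y).trans (GenLoop.boundary f y hy))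

theorem IsCoveringMap.subsingleton_homotopyGroup {E : Type*} [TopologicalSpace E] [Nontrivial N]
    [ContractibleSpace E] {p : E → X} (hp : IsCoveringMap p) (hs : Function.Surjective p)
    (x : X) : Subsingleton (HomotopyGroup N X x) := by
  refine ⟨fun a b => ?_⟩
  induction a using Quotient.inductionOn with | _ a => ?_
  induction b using Quotient.inductionOn with | _ b => ?_
  exact Quotient.sound ((hp.genLoop_homotopic_const hs a).trans
    (hp.genLoop_homotopic_const hs b).symm)

theorem IsQuotientCoveringMap.isEilenbergMacLaneOne {A : Type u} [Group A] {E X : Type*}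
    [TopologicalSpace E] [TopologicalSpace X] [MulAction A E] [ContractibleSpace E] {p : E → X}
    (hp : IsQuotientCoveringMap p A) : IsEilenbergMacLaneOne A X where
  pathConnectedSpace := hp.surjective.pathConnectedSpace hp.continuous
  fundamentalGroup x := by
    obtain ⟨e, he⟩ := hp.surjective x
    -- The covering identifies the fundamental group with the opposite of `A`; inversion removes the
    -- opposite.
    exact ⟨(hp.fundamentalGroupEquiv ⟨e, he⟩).trans (MulEquiv.inv' A).symm⟩
  higher n hn x := by
    have : Nontrivial (Fin n) := Fin.nontrivial_iff_two_le.2 hn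
    exact hp.isCoveringMap.subsingleton_homotopyGroup hp.surjective x

end HigherHomotopy

/-! ### Comparison with the classifying space of the centralizer. -/

section AsSmall

variable (C : Type) [Category.{u} C]

/-- Lifting the universe levels of a category does not change its nerve. -/
def nerveAsSmallIso : nerve (AsSmall.{u} C) ≅ nerve C :=
  NatIso.ofComponents fun n => Equiv.toIso
    { toFun x := x ⋙ AsSmall.down
      invFun x := x ⋙ AsSmall.up
      left_inv _ := rfl
      right_inv _ := rfl }

/-- Lifting the universe levels of a category does not change its classifying
space. -/
noncomputable def classifyingSpaceAsSmallHomeomorph :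
    ClassifyingSpace (AsSmall.{u} C) ≃ₜ ClassifyingSpace C :=
  TopCat.homeoOfIso (SSet.toTop.mapIso (nerveAsSmallIso C))

end AsSmall

namespace AdjointGroupoid

variable {G : Type u} [Group G]

instance (c : ConjClasses G) : IsGroupoid (Component c) where
  all_isIso f :=
    have : IsIso ((inClass c).ι.map f) := IsGroupoid.all_isIso _
    isIso_of_reflects_iso f (inClass c).ι

/-- The inclusion of the centralizer of `g`, as the automorphism group of `g`, in the subgroupoid
of the conjugacy class of `g`. -/
def centralizerFunctor (g : G) :
    SingleObj (Subgroup.centralizer {g}) ⥤ Component (ConjClasses.mk g) where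
  obj _ := ⟨⟨g⟩, rfl⟩
  map k := ObjectProperty.homMk ⟨(k : Subgroup.centralizer {g}).1,
    mul_inv_eq_of_eq_mul (Subgroup.mem_centralizer_singleton_iff.1
      (k : Subgroup.centralizer {g}).2)⟩
  map_id _ := rfl
  map_comp _ _ := rfl

instance (g : G) : (centralizerFunctor g).Faithful where
  map_injective {_ _ k l} h := by
    have h' : Component.val ((centralizerFunctor g).map k) =
      Component.val ((centralizerFunctor g).map l) := by rw [h]
    exact Subtype.ext h'

instance (g : G) : (centralizerFunctor g).Full where
  map_surjective f := ⟨⟨Component.val f, Subgroup.mem_centralizer_singleton_iff.2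
    (eq_mul_of_mul_inv_eq (Component.conj_val f))⟩, rfl⟩

instance (g : G) : (centralizerFunctor g).EssSurj where
  mem_essImage a := by
    obtain ⟨k, hk⟩ := isConj_iff.1 (ConjClasses.mk_eq_mk_iff_isConj.1 a.property.symm)
    let f : (centralizerFunctor g).obj (SingleObj.star _) ⟶ a := ObjectProperty.homMk ⟨k, hk⟩
    exact ⟨SingleObj.star _, ⟨asIso f⟩⟩

instance (g : G) : (centralizerFunctor g).IsEquivalence where

/-- The classifying space of the subgroupoid of the conjugacy class of `g` is homotopy equivalent
to the classifying space of the centralizer of `g`. -/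
noncomputable def componentHomotopyEquiv (g : G) : ContinuousMap.HomotopyEquiv
    (ClassifyingSpace (Component (ConjClasses.mk g)))
    (ClassifyingSpace (SingleObj (Subgroup.centralizer {g}))) :=
  -- The object type of `SingleObj` lies in `Type`, while `classifyingSpaceHomotopyEquiv` compares
  -- categories in equal universes; hence the passage through `AsSmall`.
  have : IsGroupoid (AsSmall.{u} (SingleObj (Subgroup.centralizer {g}))) :=
    isGroupoid_of_reflects_iso AsSmall.equiv.inverse
  (classifyingSpaceHomotopyEquiv ((centralizerFunctor g).asEquivalence.symm.trans
    AsSmall.equiv)).trans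
      (classifyingSpaceAsSmallHomeomorph (SingleObj (Subgroup.centralizer {g}))).toHomotopyEquiv

end AdjointGroupoid

theorem theorem7 (G : Type u) [Group G] :
    IsHomeomorph (AdjointGroupoid.fromCoproduct G) ∧
    ∀ g : G,
      Nonempty (ClassifyingSpace (AdjointGroupoid.Component (ConjClasses.mk g)) ≃ₜ
        MulAction.orbitRel.Quotient (Subgroup.centralizer {g})
          (ClassifyingSpace (RightGroupoid G))) ∧
      IsEilenbergMacLaneOne (Subgroup.centralizer {g})
        (ClassifyingSpace (AdjointGroupoid.Component (ConjClasses.mk g))) ∧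
      Nonempty (ContinuousMap.HomotopyEquiv
        (ClassifyingSpace (AdjointGroupoid.Component (ConjClasses.mk g)))
        (ClassifyingSpace (SingleObj (Subgroup.centralizer {g})))) :=
  ⟨AdjointGroupoid.isHomeomorph_fromCoproduct G, fun g =>
    ⟨⟨(RightGroupoid.orbitSpaceHomeomorph g).symm⟩,
      (RightGroupoid.isQuotientCoveringMap_orbitSpaceHomeomorph g).isEilenbergMacLaneOne,
      ⟨AdjointGroupoid.componentHomotopyEquiv g⟩⟩⟩
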